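/- Let $K\ge 1$, $a\in(0,1)$, and let $G$ be a probability distribution on $[0,1]^K$ with density $g$ with respect to Lebesgue measure $\ell$. Let $(\theta_i,\boldsymbol\xi_i)$, $i\ge 1$, be i.i.d. with $\theta_i\sim\mathrm{Bernoulli}(a)$ such that, given $\theta_i=0$, the $K$ coordinates of $\boldsymbol\xi_i$ are i.i.d. $\mathrm{Unif}(0,1)$ and, given $\theta_i=1$, $\boldsymbol\xi_i\sim G$. Here $\theta_i=0$ means that the $i$-th null hypothesis $H_i$ is true, and $\theta_i=1$ that it is false. Put $\alpha_*=1/(1-a+a\sup g)$, where $\sup g$ is the essential supremum of $g$ over $[0,1]^K$ (and $\alpha_*=0$ if $\sup g=\infty$). Call a family $\{D_t,\ 0\le t\le 1\}$ of Borel sets in $[0,1]^K$ a nested family if $$D_1=[0,1]^K,\qquad \ell(D_t)=t\ \ (0\le t\le 1),\qquad D_s\subset D_t\ \ (0\le s<t\le 1),\qquad D_t=\bigcap_{t<s\le 1}D_s\ \ (0\le t<1).$$ Given such a family, $\alpha\in(0,1)$ and $n\ge 1$, the procedure based on $\{D_t\}$ rejects $H_i$ ($1\le i\le n$) if and only if $\boldsymbol\xi_i\in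 D_\tau$, where $$\tau=\tau^{(n)}=\sup\Big\{t\in[0,1]:\ \frac t\alpha\le\frac{R(t)\vee 1}{n}\Big\},\qquad R(t)=\#\{i\le n:\boldsymbol\xi_i\in D_t\}.$$ Its power is $E\big[\frac{R-V}{(n-N)\vee 1}\big]$, where $R$ is the number of rejected nulls, $V$ the number of rejected true nulls and $N$ the number of true nulls among $H_1,\dots,H_n$. Denote by $\mathrm{Pow}(\alpha)$ the limit of the power as $n\to\infty$, when it exists. **Lemma 4.1.** Let $\{D_{1t}\}$ and $\{D_{2t}\}$ be two nested families such that $t\mapsto G(D_{it})$ is continuous on $[0,1]$ for $i=1,2$, and suppose that there is $T\in(0,1)$ such that $G(D_{1t})<G(D_{2t})$ for $0<t\le T$. Let $\alpha\in(\alpha_*,1)$, let $\tau_i=\tau_i^{(n)}$ be the threshold of the procedure based on $\{D_{it}\}$, and assume that, as $n\to\infty$, $\tau_i$ converges in probability to a constant $t_i^*\in(0,T)$, $i=1,2$. Then the limits $\mathrm{Pow}_1(\alpha)$ and $\mathrm{Pow}_2(\alpha)$ of the powers of the two procedures exist, and $\mathrm{Pow}_1(\alpha)<\mathrm{Pow}_2(\alpha)$.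 -/

import Mathlib

open MeasureTheory ProbabilityTheory Filter Topology
open scoped NNReal ENNReal

noncomputable section

namespace NestedFDR

/-- The unit cube `[0,1]^K`, the domain of `K`-dimensional multivariate p-values. -/
def unitCube (K : ℕ) : Set (Fin K → ℝ) := Set.Icc 0 1

/-- The law under a true null: the coordinates are i.i.d. uniform on `[0,1]`. -/
def nullLaw (K : ℕ) : Measure (Fin K → ℝ) :=
  Measure.pi fun _ : Fin K => (volume : Measure ℝ).restrict (Set.Icc 0 1)

/-- The law `G` under a false null, having density `g` on the unit cube. (It is a probability
measure as soon as it is the conditional law occurring in `RandomEffectsModel`.) -/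
def altLaw {K : ℕ} (g : (Fin K → ℝ) → ℝ≥0) : Measure (Fin K → ℝ) :=
  ((volume : Measure (Fin K → ℝ)).restrict (unitCube K)).withDensity fun x => (g x : ℝ≥0∞)

/-- The random effects model. `θ i ω = true` means that the `i`-th null is false; the multivariate
p-value of the `i`-th null is `ξ i`. The pairs `(θ i, ξ i)` are i.i.d.: they are independent and
each has the law determined by the last three fields. -/
structure RandomEffectsModel {Ω : Type*} [MeasurableSpace Ω] (P : Measure Ω) {K : ℕ}
    (a : ℝ) (g : (Fin K → ℝ) → ℝ≥0) (θ : ℕ → Ω → Bool) (ξ : ℕ → Ω → Fin K → ℝ) : Prop where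
  measurable_theta : ∀ i, Measurable (θ i)
  measurable_xi : ∀ i, Measurable (ξ i)
  indep : iIndepFun (fun i ω => (θ i ω, ξ i ω)) P
  bernoulli : ∀ i, P {ω | θ i ω = true} = ENNReal.ofReal a
  law_true_null : ∀ i, (P[|{ω | θ i ω = false}]).map (ξ i) = nullLaw K
  law_false_null : ∀ i, (P[|{ω | θ i ω = true}]).map (ξ i) = altLaw g

/-- A right-continuous nested family `D t`, `0 ≤ t ≤ 1`, of Borel subsets of the unit cube with
`D 1` the whole cube and `D t` of Lebesgue measure `t`. Nothing is required of `D t` for `t`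
outside `[0,1]`. -/
structure IsNestedFamily {K : ℕ} (D : ℝ → Set (Fin K → ℝ)) : Prop where
  measurableSet : ∀ t ∈ Set.Icc (0 : ℝ) 1, MeasurableSet (D t)
  one : D 1 = unitCube K
  volume_eq : ∀ t ∈ Set.Icc (0 : ℝ) 1, volume (D t) = ENNReal.ofReal t
  subset : ∀ s t : ℝ, 0 ≤ s → s < t → t ≤ 1 → D s ⊆ D t
  right_continuous : ∀ t ∈ Set.Ico (0 : ℝ) 1, D t = ⋂ s ∈ Set.Ioc t 1, D s

/-- `α_* = 1 / (1 - a + a sup g)`, where `sup g` is the essential supremum over the unit cube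
(so `α_* = 0` if `g` is essentially unbounded). -/
def alphaStar {K : ℕ} (a : ℝ) (g : (Fin K → ℝ) → ℝ≥0) : ℝ :=
  (1 / (ENNReal.ofReal (1 - a) + ENNReal.ofReal a *
    essSup (fun x => (g x : ℝ≥0∞))
      ((volume : Measure (Fin K → ℝ)).restrict (unitCube K)))).toReal

section Procedure

variable {Ω : Type*} {K : ℕ}

/-- `R(t)`: the number of the first `n` nulls whose p-value lies in `D t`. -/
def numRej (D : ℝ → Set (Fin K → ℝ)) (ξ : ℕ → Ω → Fin K → ℝ) (n : ℕ) (t : ℝ) (ω : Ω) : ℝ :=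
  ∑ i ∈ Finset.range n, (D t).indicator (fun _ => (1 : ℝ)) (ξ i ω)

/-- `V(t)`: the number of true ones among the first `n` nulls whose p-value lies in `D t`. -/
def numTrueRej (D : ℝ → Set (Fin K → ℝ)) (θ : ℕ → Ω → Bool) (ξ : ℕ → Ω → Fin K → ℝ)
    (n : ℕ) (t : ℝ) (ω : Ω) : ℝ :=
  ∑ i ∈ Finset.range n,
    (if θ i ω = false then 1 else 0) * (D t).indicator (fun _ => (1 : ℝ)) (ξ i ω)

/-- `N`: the number of true nulls among the first `n`. -/
def numTrue (θ : ℕ → Ω → Bool) (n : ℕ) (ω : Ω) : ℝ :=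
  ∑ i ∈ Finset.range n, if θ i ω = false then 1 else 0

/-- The data-driven threshold `τ = sup {t ∈ [0,1] : t / α ≤ (R(t) ∨ 1) / n}`. -/
def threshold (D : ℝ → Set (Fin K → ℝ)) (ξ : ℕ → Ω → Fin K → ℝ) (α : ℝ) (n : ℕ) (ω : Ω) : ℝ :=
  sSup {t : ℝ | t ∈ Set.Icc (0 : ℝ) 1 ∧ t / α ≤ max (numRej D ξ n t ω) 1 / n}

/-- The power `E[(R - V) / ((n - N) ∨ 1)]` of the procedure that rejects the `i`-th null, `i < n`,
if and only if `ξ i ∈ D τ`, with `τ` the threshold. -/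
def power [MeasurableSpace Ω] (P : Measure Ω) (D : ℝ → Set (Fin K → ℝ)) (θ : ℕ → Ω → Bool)
    (ξ : ℕ → Ω → Fin K → ℝ) (α : ℝ) (n : ℕ) : ℝ :=
  ∫ ω, (numRej D ξ n (threshold D ξ α n ω) ω - numTrueRej D θ ξ n (threshold D ξ α n ω) ω) /
    max ((n : ℝ) - numTrue θ n ω) 1 ∂P

end Procedure

end NestedFDR

end

/-! Write `F_i(t) = a G(D_{it}) + (1 - a) t` (`limitRej`), the almost sure limit of `R(t)/n`. The
threshold is itself admissible, so in the limit `t_i*/α ≤ F_i(t_i*)` (`div_le_limitRej`); no level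
above it is admissible, so `F_i(s) ≤ s/α` for `s > t_i*` (`limitRej_le_div`). If `t_2* < t_1*`, then
`t_1*/α ≤ F_1(t_1*) < F_2(t_1*) ≤ t_1*/α`, which is absurd; hence `t_1* ≤ t_2*`. The powers tend to
`G(D_{i t_i*})` (`tendsto_power`), and `G(D_{1 t_1*}) < G(D_{2 t_1*}) ≤ G(D_{2 t_2*})` by
nestedness.

The law of large numbers holds at fixed levels, while the threshold is random. Monotonicity in the
level and continuity of `G(D_{it})` bridge the gap: almost surely there is convergence at all
rational levels, hence along any convergent sequence of levels. -/

namespace NestedFDR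

/-! ### Two general tools: moving arguments and random indices -/

section Deterministic

/-- Monotone functions converging at the rationals to a function continuous at `t` converge along
any sequence of arguments tending to `t`. -/
theorem tendsto_of_monotoneOn_of_rat {M : ℕ → ℝ → ℝ} {F : ℝ → ℝ} {t : ℝ}
    (ht : t ∈ Set.Ioo (0 : ℝ) 1) (hM : ∀ n, MonotoneOn (M n) (Set.Icc 0 1))
    (hF : ContinuousAt F t)
    (hlim : ∀ q : ℚ, (q : ℝ) ∈ Set.Ioo (0 : ℝ) 1 → Tendsto (fun n => M n q) atTop (𝓝 (F q)))
    {τ : ℕ → ℝ} (hτ : Tendsto τ atTop (𝓝 t)) :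
    Tendsto (fun n => M n (τ n)) atTop (𝓝 (F t)) := by
  rw [Metric.tendsto_nhds]
  intro ε hε
  obtain ⟨δ, hδ, hδF⟩ := Metric.continuousAt_iff.1 hF (ε / 2) (half_pos hε)
  -- Rationals `q < t < r` within `δ` of `t`: eventually `M n (τ n)` lies between `M n q` and `M n
  -- r`.
  obtain ⟨q, hq, hqt⟩ := exists_rat_btwn (max_lt ht.1 (sub_lt_self t hδ))
  obtain ⟨r, htr, hr⟩ := exists_rat_btwn (lt_min ht.2 (lt_add_of_pos_right t hδ))
  obtain ⟨hq0, hqδ⟩ := max_lt_iff.1 hq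
  obtain ⟨hr1, hrδ⟩ := lt_min_iff.1 hr
  have hq1 : (q : ℝ) < 1 := hqt.trans ht.2
  have hr0 : (0 : ℝ) < r := ht.1.trans htr
  have hFq := hδF (x := (q : ℝ)) (by rw [Real.dist_eq, abs_lt]; constructor <;> linarith)
  have hFr := hδF (x := (r : ℝ)) (by rw [Real.dist_eq, abs_lt]; constructor <;> linarith)
  rw [Real.dist_eq, abs_lt] at hFq hFr
  filter_upwards [Metric.tendsto_nhds.1 (hlim q ⟨hq0, hq1⟩) _ (half_pos hε),
    Metric.tendsto_nhds.1 (hlim r ⟨hr0, hr1⟩) _ (half_pos hε),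
    hτ.eventually (Ioo_mem_nhds hqt htr)] with n hnq hnr hn
  rw [Real.dist_eq, abs_lt] at hnq hnr ⊢
  have hτI : τ n ∈ Set.Icc (0 : ℝ) 1 := ⟨(hq0.trans hn.1).le, (hn.2.trans hr1).le⟩
  have h₁ := hM n ⟨hq0.le, hq1.le⟩ hτI hn.1.le
  have h₂ := hM n hτI ⟨hr0.le, hr1.le⟩ hn.2.le
  constructor <;> linarith [hFq.1, hFr.2, hnq.1, hnr.2]

/-- Composing a countably-valued measurable index with a family of measurable functions. -/
theorem measurable_comp_of_countable_range {Ω : Type*} [MeasurableSpace Ω] {C : Set ℝ}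
    (hC : C.Countable) {τ : Ω → ℝ} (hτ : Measurable τ) (hτC : ∀ ω, τ ω ∈ C)
    {u : ℝ → Ω → ℝ} (hu : ∀ c ∈ C, Measurable (u c)) :
    Measurable fun ω => u (τ ω) ω := by
  intro A hA
  have : (fun ω => u (τ ω) ω) ⁻¹' A = ⋃ c ∈ C, (τ ⁻¹' {c} ∩ u c ⁻¹' A) := by
    ext ω
    simp only [Set.mem_preimage, Set.mem_iUnion, Set.mem_inter_iff, Set.mem_singleton_iff]
    constructor
    · exact fun h => ⟨τ ω, hτC ω, rfl, h⟩
    · rintro ⟨c, -, rfl, h⟩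
      exact h
  rw [this]
  exact MeasurableSet.biUnion hC fun c hc =>
    (hτ (measurableSet_singleton c)).inter (hu c hc hA)

end Deterministic

variable {Ω : Type*} {K : ℕ} {D : ℝ → Set (Fin K → ℝ)} {θ : ℕ → Ω → Bool}
  {ξ : ℕ → Ω → Fin K → ℝ} {α : ℝ}

theorem IsNestedFamily.mono (hD : IsNestedFamily D) {s t : ℝ} (hs : 0 ≤ s) (hst : s ≤ t)
    (ht : t ≤ 1) : D s ⊆ D t := by
  rcases hst.eq_or_lt with rfl | h
  · exact subset_rfl
  · exact hD.subset s t hs h ht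

theorem IsNestedFamily.subset_unitCube (hD : IsNestedFamily D) {t : ℝ}
    (ht : t ∈ Set.Icc (0 : ℝ) 1) : D t ⊆ unitCube K :=
  hD.one ▸ hD.mono ht.1 ht.2 le_rfl

/-! ### Rejection counts as sums over the pairs -/

section Counts

/-- The number of correctly rejected nulls at level `t`. -/
noncomputable def numFalseRej (D : ℝ → Set (Fin K → ℝ)) (θ : ℕ → Ω → Bool) (ξ : ℕ → Ω → Fin K → ℝ)
    (n : ℕ) (t : ℝ) (ω : Ω) : ℝ :=
  ∑ i ∈ Finset.range n, ({true} ×ˢ D t : Set (Bool × (Fin K → ℝ))).indicator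
    (fun _ => (1 : ℝ)) (θ i ω, ξ i ω)

theorem numRej_sub_numTrueRej (n : ℕ) (t : ℝ) (ω : Ω) :
    numRej D ξ n t ω - numTrueRej D θ ξ n t ω = numFalseRej D θ ξ n t ω := by
  rw [numRej, numTrueRej, numFalseRej, ← Finset.sum_sub_distrib]
  refine Finset.sum_congr rfl fun i _ => ?_
  by_cases h : ξ i ω ∈ D t <;> cases hθ : θ i ω <;> simp [h, Set.indicator]

theorem sub_numTrue (ξ : ℕ → Ω → Fin K → ℝ) (n : ℕ) (ω : Ω) :
    (n : ℝ) - numTrue θ n ω = ∑ i ∈ Finset.range n,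
      ({true} ×ˢ Set.univ : Set (Bool × (Fin K → ℝ))).indicator
        (fun _ => (1 : ℝ)) (θ i ω, ξ i ω) := by
  have : (n : ℝ) = ∑ i ∈ Finset.range n, (1 : ℝ) := by simp
  rw [numTrue, this, ← Finset.sum_sub_distrib]
  refine Finset.sum_congr rfl fun i _ => ?_
  cases hθ : θ i ω <;> simp [Set.indicator]

/-- Brings this count, too, into the form to which the strong law for pairs applies. -/
theorem numRej_eq_sum_indicator (θ : ℕ → Ω → Bool) (n : ℕ) (t : ℝ) (ω : Ω) :
    numRej D ξ n t ω = ∑ i ∈ Finset.range n,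
      (Set.univ ×ˢ D t : Set (Bool × (Fin K → ℝ))).indicator
        (fun _ => (1 : ℝ)) (θ i ω, ξ i ω) := by
  refine Finset.sum_congr rfl fun i _ => ?_
  by_cases h : ξ i ω ∈ D t <;> simp [h]

theorem numRej_mono (hD : IsNestedFamily D) (n : ℕ) (ω : Ω) :
    MonotoneOn (fun t => numRej D ξ n t ω) (Set.Icc 0 1) := fun _ hs _ ht hst =>
  Finset.sum_le_sum fun _ _ => Set.indicator_le_indicator_of_subset
    (hD.mono hs.1 hst ht.2) (fun _ => zero_le_one) _

theorem numFalseRej_mono (hD : IsNestedFamily D) (n : ℕ) (ω : Ω) :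
    MonotoneOn (fun t => numFalseRej D θ ξ n t ω) (Set.Icc 0 1) := fun _ hs _ ht hst =>
  Finset.sum_le_sum fun _ _ => Set.indicator_le_indicator_of_subset
    (Set.prod_mono_right (hD.mono hs.1 hst ht.2)) (fun _ => zero_le_one) _

theorem numFalseRej_nonneg (n : ℕ) (t : ℝ) (ω : Ω) : 0 ≤ numFalseRej D θ ξ n t ω :=
  Finset.sum_nonneg fun _ _ => Set.indicator_nonneg (fun _ _ => zero_le_one) _

theorem numFalseRej_le (n : ℕ) (t : ℝ) (ω : Ω) :
    numFalseRej D θ ξ n t ω ≤ (n : ℝ) - numTrue θ n ω := by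
  rw [sub_numTrue ξ]
  exact Finset.sum_le_sum fun _ _ => Set.indicator_le_indicator_of_subset
    (Set.prod_mono_right (Set.subset_univ _)) (fun _ => zero_le_one) _

theorem exists_numRej_eq_natCast (n : ℕ) (t : ℝ) (ω : Ω) :
    ∃ k ≤ n, numRej D ξ n t ω = (k : ℝ) := by
  classical
  refine ⟨((Finset.range n).filter fun i => ξ i ω ∈ D t).card,
    (Finset.card_filter_le _ _).trans (Finset.card_range n).le, ?_⟩
  simp [numRej, Set.indicator]

end Counts

/-! ### The threshold: attainment and measurability -/

section Threshold

/-- The set of levels whose supremum is the threshold. -/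
def admissible (D : ℝ → Set (Fin K → ℝ)) (ξ : ℕ → Ω → Fin K → ℝ) (α : ℝ) (n : ℕ) (ω : Ω) :
    Set ℝ :=
  {t : ℝ | t ∈ Set.Icc (0 : ℝ) 1 ∧ t / α ≤ max (numRej D ξ n t ω) 1 / n}

/-- The largest level that is admissible when exactly `k` nulls are rejected. -/
noncomputable def gridLevel (α : ℝ) (n k : ℕ) : ℝ := min 1 (α * (max (k : ℝ) 1 / n))

theorem gridLevel_mem_Icc (hα : 0 < α) (n k : ℕ) : gridLevel α n k ∈ Set.Icc (0 : ℝ) 1 :=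
  ⟨le_min zero_le_one (by positivity), min_le_left _ _⟩

theorem le_threshold {n : ℕ} {ω : Ω} {t : ℝ} (ht : t ∈ admissible D ξ α n ω) :
    t ≤ threshold D ξ α n ω :=
  le_csSup ⟨1, fun _ h => h.1.2⟩ ht

/-- With `k` rejections at `t`, raising the level to `gridLevel α n k` can only increase the count,
so admissibility survives. The supremum thus runs over finitely many levels. -/
theorem exists_gridLevel_mem_admissible (hD : IsNestedFamily D) (hα : 0 < α) {n : ℕ} {ω : Ω}
    {t : ℝ} (ht : t ∈ admissible D ξ α n ω) :
    ∃ k ∈ Finset.range (n + 1), gridLevel α n k ∈ admissible D ξ α n ω ∧ t ≤ gridLevel α n k := by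
  obtain ⟨k, hkn, hk⟩ := exists_numRej_eq_natCast (D := D) (ξ := ξ) n t ω
  have htk : t ≤ gridLevel α n k := by
    have := ht.2
    rw [hk, div_le_iff₀' hα] at this
    exact le_min ht.1.2 this
  refine ⟨k, Finset.mem_range.2 (Nat.lt_succ_of_le hkn),
    ⟨gridLevel_mem_Icc hα n k, ?_⟩, htk⟩
  have hmono := numRej_mono (ξ := ξ) hD n ω ht.1 (gridLevel_mem_Icc hα n k) htk
  simp only [hk] at hmono
  rw [div_le_iff₀' hα]
  refine (min_le_right _ _).trans ?_
  gcongr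

theorem zero_mem_admissible (n : ℕ) (ω : Ω) : (0 : ℝ) ∈ admissible D ξ α n ω :=
  ⟨⟨le_rfl, zero_le_one⟩, by simp only [zero_div]; positivity⟩

/-- The threshold is the largest admissible grid level. -/
theorem exists_threshold_eq_gridLevel (hD : IsNestedFamily D) (hα : 0 < α) (n : ℕ) (ω : Ω) :
    ∃ k ∈ Finset.range (n + 1), threshold D ξ α n ω = gridLevel α n k ∧
      gridLevel α n k ∈ admissible D ξ α n ω := by
  classical
  let s := (Finset.range (n + 1)).filter fun k => gridLevel α n k ∈ admissible D ξ α n ω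
  have hs : s.Nonempty := by
    obtain ⟨k, hk, hkA, -⟩ := exists_gridLevel_mem_admissible hD hα
      (zero_mem_admissible (D := D) (ξ := ξ) (α := α) n ω)
    exact ⟨k, Finset.mem_filter.2 ⟨hk, hkA⟩⟩
  obtain ⟨k, hk, hmax⟩ := s.exists_max_image (gridLevel α n) hs
  obtain ⟨hkn, hkA⟩ := Finset.mem_filter.1 hk
  refine ⟨k, hkn, le_antisymm (csSup_le ⟨_, hkA⟩ fun t ht => ?_) (le_threshold hkA), hkA⟩
  obtain ⟨j, hj, hjA, htj⟩ := exists_gridLevel_mem_admissible hD hα ht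
  exact htj.trans (hmax j (Finset.mem_filter.2 ⟨hj, hjA⟩))

theorem threshold_mem_admissible (hD : IsNestedFamily D) (hα : 0 < α) (n : ℕ) (ω : Ω) :
    threshold D ξ α n ω ∈ admissible D ξ α n ω := by
  obtain ⟨k, -, hk, hkA⟩ := exists_threshold_eq_gridLevel (ξ := ξ) hD hα n ω
  exact hk ▸ hkA

theorem measurable_numRej [MeasurableSpace Ω] (hξ : ∀ i, Measurable (ξ i)) (n : ℕ) {t : ℝ}
    (ht : MeasurableSet (D t)) : Measurable fun ω => numRej D ξ n t ω :=
  Finset.measurable_fun_sum _ fun i _ => (measurable_const.indicator ht).comp (hξ i)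

theorem measurable_numFalseRej [MeasurableSpace Ω] (hθ : ∀ i, Measurable (θ i))
    (hξ : ∀ i, Measurable (ξ i)) (n : ℕ) {t : ℝ} (ht : MeasurableSet (D t)) :
    Measurable fun ω => numFalseRej D θ ξ n t ω :=
  Finset.measurable_fun_sum _ fun i _ =>
    (measurable_const.indicator ((measurableSet_singleton true).prod ht)).comp
      ((hθ i).prodMk (hξ i))

theorem measurable_numTrue [MeasurableSpace Ω] (hθ : ∀ i, Measurable (θ i)) (n : ℕ) :
    Measurable fun ω => numTrue θ n ω :=
  Finset.measurable_fun_sum _ fun i _ =>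
    Measurable.ite (hθ i (measurableSet_singleton false)) measurable_const measurable_const

theorem measurable_threshold [MeasurableSpace Ω] (hD : IsNestedFamily D) (hα : 0 < α)
    (hξ : ∀ i, Measurable (ξ i)) (n : ℕ) : Measurable (threshold D ξ α n) := by
  classical
  have heq : threshold D ξ α n = fun ω => (Finset.range (n + 1)).sup' ⟨0, by simp⟩
      (fun k => {ω | gridLevel α n k ∈ admissible D ξ α n ω}.indicator
        (fun _ => gridLevel α n k) ω) := by
    ext ω
    refine le_antisymm ?_ (Finset.sup'_le _ _ fun k _ => ?_)
    · obtain ⟨k, hk, hkτ, hkA⟩ := exists_threshold_eq_gridLevel (ξ := ξ) hD hα n ω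
      refine Finset.le_sup'_of_le _ hk ?_
      rw [Set.indicator_of_mem (by exact hkA), hkτ]
    · by_cases h : gridLevel α n k ∈ admissible D ξ α n ω
      · rw [Set.indicator_of_mem (by exact h)]
        exact le_threshold h
      -- The indicator's default value `0` is harmless, since level `0` is always admissible.
      · rw [Set.indicator_of_notMem (by exact h)]
        exact le_threshold (zero_mem_admissible n ω)
  rw [heq]
  refine Finset.measurable_range_sup'' (n := n) fun k _ => measurable_const.indicator ?_
  have hk := gridLevel_mem_Icc hα n k
  have : {ω | gridLevel α n k ∈ admissible D ξ α n ω} =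
      {ω | gridLevel α n k / α ≤ max (numRej D ξ n (gridLevel α n k) ω) 1 / n} := by
    ext ω
    exact and_iff_right hk
  rw [this]
  exact measurableSet_le measurable_const
    (((measurable_numRej hξ n (hD.measurableSet _ hk)).max measurable_const).div_const _)

/-- The threshold takes countably many values, so measurability at each fixed level suffices. -/
theorem measurable_numFalseRej_threshold [MeasurableSpace Ω] (hD : IsNestedFamily D) (hα : 0 < α)
    (hθ : ∀ i, Measurable (θ i)) (hξ : ∀ i, Measurable (ξ i)) (n : ℕ) :
    Measurable fun ω => numFalseRej D θ ξ n (threshold D ξ α n ω) ω := by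
  refine measurable_comp_of_countable_range (C := Set.range (gridLevel α n))
    (Set.countable_range _) (measurable_threshold hD hα hξ n) (fun ω => ?_) ?_
  · obtain ⟨k, -, hk, -⟩ := exists_threshold_eq_gridLevel (ξ := ξ) hD hα n ω
    exact ⟨k, hk.symm⟩
  · rintro _ ⟨k, rfl⟩
    exact measurable_numFalseRej hθ hξ n (hD.measurableSet _ (gridLevel_mem_Icc hα n k))

end Threshold

/-! ### Law of the pairs and the strong law -/

section Laws

theorem nullLaw_eq_restrict (K : ℕ) :
    nullLaw K = (volume : Measure (Fin K → ℝ)).restrict (unitCube K) := by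
  rw [nullLaw, ← Measure.restrict_pi_pi, ← volume_pi, unitCube, ← Set.pi_univ_Icc]
  rfl

theorem IsNestedFamily.nullLaw_apply (hD : IsNestedFamily D) {t : ℝ}
    (ht : t ∈ Set.Icc (0 : ℝ) 1) : nullLaw K (D t) = ENNReal.ofReal t := by
  rw [nullLaw_eq_restrict, Measure.restrict_apply (hD.measurableSet t ht),
    Set.inter_eq_left.2 (hD.subset_unitCube ht), hD.volume_eq t ht]

/-- The common law of the pairs `(θ i, ξ i)` in the random effects model. -/
noncomputable def jointLaw (a : ℝ) (g : (Fin K → ℝ) → ℝ≥0) : Measure (Bool × (Fin K → ℝ)) :=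
  ENNReal.ofReal a • (altLaw g).map (Prod.mk true) +
    ENNReal.ofReal (1 - a) • (nullLaw K).map (Prod.mk false)

theorem jointLaw_prod {a : ℝ} {g : (Fin K → ℝ) → ℝ≥0} {A : Set Bool} {B : Set (Fin K → ℝ)}
    (hB : MeasurableSet B) : jointLaw a g (A ×ˢ B) =
      ENNReal.ofReal a * A.indicator (fun _ => altLaw g B) true +
        ENNReal.ofReal (1 - a) * A.indicator (fun _ => nullLaw K B) false := by
  classical
  have hA : MeasurableSet A := A.toFinite.measurableSet
  rw [jointLaw, Measure.add_apply, Measure.smul_apply, Measure.smul_apply,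
    Measure.map_apply measurable_prodMk_left (hA.prod hB),
    Measure.map_apply measurable_prodMk_left (hA.prod hB)]
  by_cases h₁ : true ∈ A <;> by_cases h₂ : false ∈ A <;>
    simp [h₁, h₂, Set.mk_preimage_prod_right, Set.mk_preimage_prod_right_eq_empty]

variable [MeasurableSpace Ω] {P : Measure Ω} [IsProbabilityMeasure P] {a : ℝ}
  {g : (Fin K → ℝ) → ℝ≥0}

theorem RandomEffectsModel.prob_false (h : RandomEffectsModel P a g θ ξ) (ha : 0 ≤ a) (i : ℕ) :
    P {ω | θ i ω = false} = ENNReal.ofReal (1 - a) := by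
  have hm : MeasurableSet {ω | θ i ω = true} :=
    h.measurable_theta i (measurableSet_singleton true)
  have : {ω | θ i ω = false} = {ω | θ i ω = true}ᶜ := by ext; simp
  rw [this, prob_compl_eq_one_sub hm, h.bernoulli, ENNReal.ofReal_sub _ ha, ENNReal.ofReal_one]

theorem RandomEffectsModel.isProbabilityMeasure_altLaw (h : RandomEffectsModel P a g θ ξ)
    (ha : 0 < a) : IsProbabilityMeasure (altLaw g) := by
  have : IsProbabilityMeasure (P[|{ω | θ 0 ω = true}]) :=
    cond_isProbabilityMeasure (by rw [h.bernoulli]; simpa using ha)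
  exact h.law_false_null 0 ▸ Measure.isProbabilityMeasure_map (h.measurable_xi 0).aemeasurable

theorem RandomEffectsModel.map_pair (h : RandomEffectsModel P a g θ ξ) (ha : 0 ≤ a) (i : ℕ) :
    P.map (fun ω => (θ i ω, ξ i ω)) = jointLaw a g := by
  have hpair := (h.measurable_theta i).prodMk (h.measurable_xi i)
  have hT : MeasurableSet {ω | θ i ω = true} := h.measurable_theta i (measurableSet_singleton true)
  have hF : MeasurableSet {ω | θ i ω = false} :=
    h.measurable_theta i (measurableSet_singleton false)
  ext S hS
  have hcompl : {ω | θ i ω = true}ᶜ = {ω | θ i ω = false} := by ext; simp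
  rw [Measure.map_apply hpair hS, ← measure_inter_add_sdiff _ hT, Set.sdiff_eq, hcompl, jointLaw,
    Measure.add_apply, Measure.smul_apply, Measure.smul_apply,
    Measure.map_apply measurable_prodMk_left hS, Measure.map_apply measurable_prodMk_left hS,
    ← h.law_false_null i, ← h.law_true_null i,
    Measure.map_apply (h.measurable_xi i) (measurable_prodMk_left hS),
    Measure.map_apply (h.measurable_xi i) (measurable_prodMk_left hS),
    smul_eq_mul, smul_eq_mul, ← h.bernoulli i, ← h.prob_false ha i, mul_comm, mul_comm (P _),
    cond_mul_eq_inter hT, cond_mul_eq_inter hF]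
  congr 2
  · ext ω
    simp only [Set.mem_inter_iff, Set.mem_preimage, Set.mem_ofPred_eq]
    constructor
    · rintro ⟨h₁, h₂⟩; exact ⟨h₂, h₂ ▸ h₁⟩
    · rintro ⟨h₁, h₂⟩; exact ⟨h₁ ▸ h₂, h₁⟩
  · ext ω
    simp only [Set.mem_inter_iff, Set.mem_preimage, Set.mem_ofPred_eq]
    constructor
    · rintro ⟨h₁, h₂⟩; exact ⟨h₂, h₂ ▸ h₁⟩
    · rintro ⟨h₁, h₂⟩; exact ⟨h₁ ▸ h₂, h₁⟩

/-- Strong law of large numbers for the number of pairs falling into a measurable set. -/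
theorem RandomEffectsModel.ae_tendsto_frequency (h : RandomEffectsModel P a g θ ξ) (ha : 0 ≤ a)
    {S : Set (Bool × (Fin K → ℝ))} (hS : MeasurableSet S) :
    ∀ᵐ ω ∂P, Tendsto (fun n : ℕ => (∑ i ∈ Finset.range n,
      S.indicator (fun _ => (1 : ℝ)) (θ i ω, ξ i ω)) / n) atTop (𝓝 ((jointLaw a g).real S)) := by
  have hf : Measurable (S.indicator fun _ => (1 : ℝ)) := measurable_const.indicator hS
  have hpair := fun i => (h.measurable_theta i).prodMk (h.measurable_xi i)
  have hint : Integrable (fun ω => S.indicator (fun _ => (1 : ℝ)) (θ 0 ω, ξ 0 ω)) P :=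
    Integrable.of_bound (hf.comp (hpair 0)).aestronglyMeasurable 1
      (Eventually.of_forall fun ω => (norm_indicator_le_norm_self _ _).trans norm_one.le)
  have key := strong_law_ae_real (fun i ω => S.indicator (fun _ => (1 : ℝ)) (θ i ω, ξ i ω)) hint
    (fun i j hij => (h.indep.indepFun hij).comp hf hf)
    (fun i => IdentDistrib.comp (f := fun ω => (θ i ω, ξ i ω)) (g := fun ω => (θ 0 ω, ξ 0 ω))
      ⟨(hpair i).aemeasurable, (hpair 0).aemeasurable,
        (h.map_pair ha i).trans (h.map_pair ha 0).symm⟩ hf)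
  have hmean : ∫ ω, S.indicator (fun _ => (1 : ℝ)) (θ 0 ω, ξ 0 ω) ∂P = (jointLaw a g).real S := by
    rw [← h.map_pair ha 0, ← integral_indicator_one hS,
      integral_map (hpair 0).aemeasurable (by exact hf.aestronglyMeasurable)]
    rfl
  rwa [hmean] at key

end Laws

/-! ### Limits of the counts, of the power and of the threshold inequality -/

section Asymptotics

variable [MeasurableSpace Ω] {P : Measure Ω} [IsProbabilityMeasure P] {a : ℝ}
  {g : (Fin K → ℝ) → ℝ≥0}

/-- The limit of the proportion of rejections at level `t`. -/
noncomputable def limitRej (a : ℝ) (g : (Fin K → ℝ) → ℝ≥0) (D : ℝ → Set (Fin K → ℝ)) (t : ℝ) : ℝ :=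
  a * (altLaw g).real (D t) + (1 - a) * t

theorem RandomEffectsModel.ae_tendsto_numRej (h : RandomEffectsModel P a g θ ξ)
    (ha : a ∈ Set.Ioo (0 : ℝ) 1) (hD : IsNestedFamily D) {t : ℝ} (ht : t ∈ Set.Icc (0 : ℝ) 1) :
    ∀ᵐ ω ∂P, Tendsto (fun n : ℕ => max (numRej D ξ n t ω) 1 / n) atTop
      (𝓝 (limitRej a g D t)) := by
  have := h.isProbabilityMeasure_altLaw ha.1
  have hm := hD.measurableSet t ht
  have hval : (jointLaw a g).real (Set.univ ×ˢ D t) = limitRej a g D t := by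
    rw [measureReal_def, jointLaw_prod hm, Set.indicator_of_mem (Set.mem_univ _),
      Set.indicator_of_mem (Set.mem_univ _), hD.nullLaw_apply ht, ENNReal.toReal_add
        (ENNReal.mul_ne_top ENNReal.ofReal_ne_top (measure_ne_top _ _))
        (ENNReal.mul_ne_top ENNReal.ofReal_ne_top ENNReal.ofReal_ne_top),
      ENNReal.toReal_mul, ENNReal.toReal_mul, ENNReal.toReal_ofReal ha.1.le,
      ENNReal.toReal_ofReal (sub_nonneg.2 ha.2.le), ENNReal.toReal_ofReal ht.1]
    rfl
  have hnn : 0 ≤ limitRej a g D t := hval ▸ measureReal_nonneg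
  filter_upwards [h.ae_tendsto_frequency ha.1.le (MeasurableSet.univ.prod hm)] with ω hω
  rw [hval] at hω
  simp only [← numRej_eq_sum_indicator θ] at hω
  have := hω.max (tendsto_one_div_atTop_nhds_zero_nat (𝕜 := ℝ))
  rw [max_eq_left hnn] at this
  exact this.congr fun n => (max_div_div_right n.cast_nonneg _ _)

theorem RandomEffectsModel.ae_tendsto_numFalseRej (h : RandomEffectsModel P a g θ ξ)
    (ha : a ∈ Set.Ioo (0 : ℝ) 1) (hD : IsNestedFamily D) {t : ℝ} (ht : t ∈ Set.Icc (0 : ℝ) 1) :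
    ∀ᵐ ω ∂P, Tendsto (fun n : ℕ => numFalseRej D θ ξ n t ω / max ((n : ℝ) - numTrue θ n ω) 1) atTop
      (𝓝 ((altLaw g).real (D t))) := by
  have := h.isProbabilityMeasure_altLaw ha.1
  have hm := hD.measurableSet t ht
  have hval : ∀ B : Set (Fin K → ℝ), MeasurableSet B →
      (jointLaw a g).real ({true} ×ˢ B) = a * (altLaw g).real B := fun B hB => by
    rw [measureReal_def, jointLaw_prod hB]
    simp [measureReal_def, ha.1.le]
  filter_upwards [h.ae_tendsto_frequency ha.1.le ((measurableSet_singleton true).prod hm),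
    h.ae_tendsto_frequency ha.1.le ((measurableSet_singleton true).prod MeasurableSet.univ)]
    with ω h₁ h₂
  rw [hval _ hm] at h₁
  rw [hval _ MeasurableSet.univ, probReal_univ, mul_one] at h₂
  simp only [← sub_numTrue ξ] at h₂
  have h₃ := h₂.max (tendsto_one_div_atTop_nhds_zero_nat (𝕜 := ℝ))
  rw [max_eq_left ha.1.le] at h₃
  -- After division by `n`, numerator and denominator tend to `a G(D t)` and `a`.
  have h₄ := h₁.div h₃ ha.1.ne'
  rw [mul_div_cancel_left₀ _ ha.1.ne'] at h₄
  refine h₄.congr' ?_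
  filter_upwards [eventually_gt_atTop 0] with n hn
  have hn' : (n : ℝ) ≠ 0 := Nat.cast_ne_zero.2 hn.ne'
  rw [Pi.div_apply, max_div_div_right n.cast_nonneg, div_div_div_cancel_right₀ hn']
  rfl

theorem continuousAt_altLaw_real (h : RandomEffectsModel P a g θ ξ) (ha : 0 < a)
    (hcont : ContinuousOn (fun t => altLaw g (D t)) (Set.Icc 0 1)) {t : ℝ}
    (ht : t ∈ Set.Ioo (0 : ℝ) 1) : ContinuousAt (fun t => (altLaw g).real (D t)) t := by
  have := h.isProbabilityMeasure_altLaw ha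
  exact (ENNReal.tendsto_toReal (measure_ne_top _ _)).comp
    (hcont.continuousAt (Icc_mem_nhds ht.1 ht.2))

/-- The power converges to the probability under the alternative of the limiting rejection set. -/
theorem RandomEffectsModel.tendsto_power (h : RandomEffectsModel P a g θ ξ)
    (ha : a ∈ Set.Ioo (0 : ℝ) 1) (hD : IsNestedFamily D) (hα : 0 < α)
    (hcont : ContinuousOn (fun t => altLaw g (D t)) (Set.Icc 0 1)) {t : ℝ}
    (ht : t ∈ Set.Ioo (0 : ℝ) 1)
    (hτ : TendstoInMeasure P (fun n => threshold D ξ α n) atTop (fun _ => t)) :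
    Tendsto (fun n => power P D θ ξ α n) atTop (𝓝 ((altLaw g).real (D t))) := by
  -- Passing to sub-subsequences turns convergence in probability into almost sure convergence; the
  -- integrands are bounded by `1`.
  refine tendsto_of_subseq_tendsto fun ns hns => ?_
  obtain ⟨ms, hms, hae⟩ := (hτ.comp hns).exists_seq_tendsto_ae
  refine ⟨ms, ?_⟩
  have hsub : Tendsto (fun k => ns (ms k)) atTop atTop := hns.comp hms.tendsto_atTop
  simp only [power, numRej_sub_numTrueRej]
  rw [show (altLaw g).real (D t) = ∫ _, (altLaw g).real (D t) ∂P by simp]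
  refine tendsto_integral_of_dominated_convergence (fun _ => (1 : ℝ)) (fun k => ?_)
    (integrable_const _) (fun k => Eventually.of_forall fun ω => ?_) ?_
  · exact ((measurable_numFalseRej_threshold hD hα h.measurable_theta h.measurable_xi _).div
      ((measurable_const.sub (measurable_numTrue h.measurable_theta _)).max
        measurable_const)).aestronglyMeasurable
  · have hpos : (0 : ℝ) < max ((ns (ms k) : ℝ) - numTrue θ (ns (ms k)) ω) 1 :=
      lt_max_of_lt_right one_pos
    rw [Real.norm_of_nonneg (div_nonneg (numFalseRej_nonneg _ _ _) hpos.le), div_le_one hpos]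
    exact (numFalseRej_le _ _ _).trans (le_max_left _ _)
  · have hall : ∀ᵐ ω ∂P, ∀ q : ℚ, (q : ℝ) ∈ Set.Ioo (0 : ℝ) 1 →
        Tendsto (fun n : ℕ => numFalseRej D θ ξ n q ω / max ((n : ℝ) - numTrue θ n ω) 1) atTop
          (𝓝 ((altLaw g).real (D q))) :=
      ae_all_iff.2 fun q => eventually_imp_distrib_left.2 fun hq =>
        h.ae_tendsto_numFalseRej ha hD (Set.Ioo_subset_Icc_self hq)
    filter_upwards [hall, hae] with ω hω hτω
    exact tendsto_of_monotoneOn_of_rat (F := fun t => (altLaw g).real (D t))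
      (M := fun k s => numFalseRej D θ ξ (ns (ms k)) s ω /
        max ((ns (ms k) : ℝ) - numTrue θ (ns (ms k)) ω) 1) ht
      (fun k s hs u hu hsu => div_le_div_of_nonneg_right
        (numFalseRej_mono hD _ ω hs hu hsu) (zero_le_one.trans (le_max_right _ _)))
      (continuousAt_altLaw_real h ha.1 hcont ht) (fun q hq => (hω q hq).comp hsub) hτω

theorem RandomEffectsModel.div_le_limitRej (h : RandomEffectsModel P a g θ ξ)
    (ha : a ∈ Set.Ioo (0 : ℝ) 1) (hD : IsNestedFamily D) (hα : 0 < α)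
    (hcont : ContinuousOn (fun t => altLaw g (D t)) (Set.Icc 0 1)) {t : ℝ}
    (ht : t ∈ Set.Ioo (0 : ℝ) 1)
    (hτ : TendstoInMeasure P (fun n => threshold D ξ α n) atTop (fun _ => t)) :
    t / α ≤ limitRej a g D t := by
  obtain ⟨ms, hms, hae⟩ := hτ.exists_seq_tendsto_ae
  have hall : ∀ᵐ ω ∂P, ∀ q : ℚ, (q : ℝ) ∈ Set.Ioo (0 : ℝ) 1 →
      Tendsto (fun n : ℕ => max (numRej D ξ n q ω) 1 / n) atTop (𝓝 (limitRej a g D q)) :=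
    ae_all_iff.2 fun q => eventually_imp_distrib_left.2 fun hq =>
      h.ae_tendsto_numRej ha hD (Set.Ioo_subset_Icc_self hq)
  -- The claim is deterministic, so a single good `ω` is enough.
  obtain ⟨ω, hω, hτω⟩ := (hall.and hae).exists
  refine le_of_tendsto_of_tendsto' (hτω.div_const α)
    (tendsto_of_monotoneOn_of_rat (F := limitRej a g D)
      (M := fun k s => max (numRej D ξ (ms k) s ω) 1 / (ms k : ℝ)) ht
      (fun k s hs u hu hsu => div_le_div_of_nonneg_right
        (max_le_max_right _ (numRej_mono hD _ ω hs hu hsu)) (Nat.cast_nonneg _))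
      ?_ (fun q hq => (hω q hq).comp hms.tendsto_atTop) hτω)
    fun k => (threshold_mem_admissible hD hα (ms k) ω).2
  exact (continuousAt_const.mul (continuousAt_altLaw_real h ha.1 hcont ht)).add
    (continuousAt_const.mul continuousAt_id)

/-- A level `s` above the limit eventually exceeds the threshold along a subsequence, hence is not
admissible. Only convergence at the fixed level `s` is needed, so continuity plays no role. -/
theorem RandomEffectsModel.limitRej_le_div (h : RandomEffectsModel P a g θ ξ)
    (ha : a ∈ Set.Ioo (0 : ℝ) 1) (hD : IsNestedFamily D) {s t : ℝ}
    (hs : s ∈ Set.Icc (0 : ℝ) 1) (hts : t < s)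
    (hτ : TendstoInMeasure P (fun n => threshold D ξ α n) atTop (fun _ => t)) :
    limitRej a g D s ≤ s / α := by
  obtain ⟨ms, hms, hae⟩ := hτ.exists_seq_tendsto_ae
  obtain ⟨ω, hω, hτω⟩ := ((h.ae_tendsto_numRej ha hD hs).and hae).exists
  refine le_of_tendsto (hω.comp hms.tendsto_atTop) ?_
  filter_upwards [hτω.eventually_lt_const hts] with k hk
  by_contra! hlt
  exact absurd (le_threshold (D := D) (ξ := ξ) ⟨hs, hlt.le⟩) (not_le.2 hk)

end Asymptotics

end NestedFDR

theorem lemma4p1 {Ω : Type*} [MeasurableSpace Ω] (P : Measure Ω) [IsProbabilityMeasure P]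
    {K : ℕ} (a : ℝ) (ha : a ∈ Set.Ioo (0 : ℝ) 1)
    (g : (Fin K → ℝ) → ℝ≥0) (hg : Measurable g)
    (θ : ℕ → Ω → Bool) (ξ : ℕ → Ω → Fin K → ℝ)
    (hmodel : NestedFDR.RandomEffectsModel P a g θ ξ)
    (D₁ D₂ : ℝ → Set (Fin K → ℝ))
    (hD₁ : NestedFDR.IsNestedFamily D₁) (hD₂ : NestedFDR.IsNestedFamily D₂)
    (hcont₁ : ContinuousOn (fun t => NestedFDR.altLaw g (D₁ t)) (Set.Icc 0 1))
    (hcont₂ : ContinuousOn (fun t => NestedFDR.altLaw g (D₂ t)) (Set.Icc 0 1))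
    (T : ℝ) (hT : T ∈ Set.Ioo (0 : ℝ) 1)
    (hlt : ∀ t, 0 < t → t ≤ T → NestedFDR.altLaw g (D₁ t) < NestedFDR.altLaw g (D₂ t))
    (α : ℝ) (hα : α ∈ Set.Ioo (NestedFDR.alphaStar a g) 1)
    (t₁ t₂ : ℝ) (ht₁ : t₁ ∈ Set.Ioo 0 T) (ht₂ : t₂ ∈ Set.Ioo 0 T)
    (hτ₁ : TendstoInMeasure P (fun n => NestedFDR.threshold D₁ ξ α n) atTop (fun _ => t₁))
    (hτ₂ : TendstoInMeasure P (fun n => NestedFDR.threshold D₂ ξ α n) atTop (fun _ => t₂)) :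
    ∃ pow₁ pow₂ : ℝ,
      Tendsto (fun n => NestedFDR.power P D₁ θ ξ α n) atTop (𝓝 pow₁) ∧
      Tendsto (fun n => NestedFDR.power P D₂ θ ξ α n) atTop (𝓝 pow₂) ∧
      pow₁ < pow₂ := by
  have hα₀ : 0 < α := lt_of_le_of_lt ENNReal.toReal_nonneg hα.1
  have := hmodel.isProbabilityMeasure_altLaw ha.1
  have ht₁' : t₁ ∈ Set.Ioo (0 : ℝ) 1 := ⟨ht₁.1, ht₁.2.trans hT.2⟩
  have ht₂' : t₂ ∈ Set.Ioo (0 : ℝ) 1 := ⟨ht₂.1, ht₂.2.trans hT.2⟩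
  have hG : (NestedFDR.altLaw g).real (D₁ t₁) < (NestedFDR.altLaw g).real (D₂ t₁) :=
    ENNReal.toReal_strict_mono (measure_ne_top _ _) (hlt t₁ ht₁.1 ht₁.2.le)
  have hle : t₁ ≤ t₂ := by
    by_contra! hgt
    have h₁ := hmodel.div_le_limitRej ha hD₁ hα₀ hcont₁ ht₁' hτ₁
    have h₂ := hmodel.limitRej_le_div ha hD₂ (Set.Ioo_subset_Icc_self ht₁') hgt hτ₂
    have h₃ := mul_lt_mul_of_pos_left hG ha.1
    simp only [NestedFDR.limitRej] at h₁ h₂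
    linarith
  exact ⟨_, _, hmodel.tendsto_power ha hD₁ hα₀ hcont₁ ht₁' hτ₁,
    hmodel.tendsto_power ha hD₂ hα₀ hcont₂ ht₂' hτ₂,
    hG.trans_le (measureReal_mono (hD₂.mono ht₁.1.le hle ht₂'.2.le))⟩
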